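/- Let $q=2^n$ with $n\ge 1$, let $k\ge 1$, let $d=2^k+1$ (a Gold exponent), and let $f(x)=x^d+g(x)$ with $g\in\mathbb F_q[x]$, $\deg g<d$. If $k=2$, assume moreover that the coefficient of $x^3$ in $g$ is nonzero. Define the polynomial $$\phi(x,y,z)=\frac{f(x)+f(y)+f(z)+f(x+y+z)}{(x+y)(x+z)(y+z)}\in\mathbb F_q[x,y,z],$$ and let $\overline X\subset\mathbb P^3$ be the projective closure of the affine surface $X:\ \phi(x,y,z)=0$; its equation is the homogenization $\overline\phi(x,y,z,t)=0$ of $\phi$. If $\phi(x,y,y)=P(x,y)^2$ for some absolutely irreducible polynomial $P\in\mathbb F_q[x,y]$, then $\overline X$ is absolutely irreducible; that is, $\overline\phi$ is irreducible over the algebraic closure $\overline{\mathbb F}_q$, and the set of $\overline{\mathbb F}_q$-points of $\overline X$ (the Zariski closure of $X(\overline{\mathbb F}_q)$ in $\mathbb P^3(\overline{\mathbb F}_q)$) is irreducible. -/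

import Mathlib

noncomputable section

namespace GoldAPN

open MvPolynomial

/-- The polynomial `f(x) + f(y) + f(z) + f(x+y+z)` in the variables `x = X 0`, `y = X 1`,
`z = X 2`. -/
def numerator {F : Type*} [Field F] (f : Polynomial F) : MvPolynomial (Fin 3) F :=
  Polynomial.aeval (X 0) f + Polynomial.aeval (X 1) f + Polynomial.aeval (X 2) f
    + Polynomial.aeval (X 0 + X 1 + X 2) f

/-- The polynomial `(x+y)(x+z)(y+z)`. -/
def denominator (F : Type*) [Field F] : MvPolynomial (Fin 3) F :=
  (X 0 + X 1) * (X 0 + X 2) * (X 1 + X 2)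

/-- In characteristic two, `(x+y)(x+z)(y+z)` divides `x^j + y^j + z^j + (x+y+z)^j`. -/
theorem dvd_pow_sum {R : Type*} [CommRing R] [CharP R 2] (x y z : R) (j : ℕ) :
    (x + y) * (x + z) * (y + z) ∣ x ^ j + y ^ j + z ^ j + (x + y + z) ^ j := by
  have h2 : (2 : R) = 0 := CharTwo.two_eq_zero
  induction j using Nat.strong_induction_on with
  | _ j ih =>
    match j, ih with
    | 0, _ => exact ⟨0, by linear_combination 2 * h2⟩
    | 1, _ => exact ⟨0, by linear_combination (x + y + z) * h2⟩
    | 2, _ => exact ⟨0, by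
        linear_combination (x ^ 2 + y ^ 2 + z ^ 2 + x * y + x * z + y * z) * h2⟩
    | 3, _ => exact ⟨1, by
        linear_combination (x ^ 3 + y ^ 3 + z ^ 3 + x ^ 2 * y + x ^ 2 * z + y ^ 2 * x + y ^ 2 * z
          + z ^ 2 * x + z ^ 2 * y + 2 * x * y * z) * h2⟩
    | n + 4, ih =>
      obtain ⟨a, ha⟩ := ih n (by omega)
      obtain ⟨b, hb⟩ := ih (n + 1) (by omega)
      obtain ⟨c, hc⟩ := ih (n + 2) (by omega)
      obtain ⟨e, he⟩ := ih (n + 3) (by omega)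
      refine ⟨2 * (x + y + z) * e
        - (x * y + x * z + y * z + (x + y + z) ^ 2) * c
        + (x * y * z + (x * y + x * z + y * z) * (x + y + z)) * b
        - x * y * z * (x + y + z) * a, ?_⟩
      linear_combination (2 * (x + y + z)) * he
        - (x * y + x * z + y * z + (x + y + z) ^ 2) * hc
        + (x * y * z + (x * y + x * z + y * z) * (x + y + z)) * hb
        - x * y * z * (x + y + z) * ha

theorem denominator_dvd_numerator {F : Type*} [Field F] [CharP F 2] (f : Polynomial F) :
    denominator F ∣ numerator f := by
  induction f using Polynomial.induction_on' with
  | add p q hp hq =>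
    have h : numerator (p + q) = numerator p + numerator q := by
      simp only [numerator, map_add]; ring
    rw [h]; exact dvd_add hp hq
  | monomial n a =>
    have h : numerator (Polynomial.monomial n a)
        = C a * (X 0 ^ n + X 1 ^ n + X 2 ^ n + (X 0 + X 1 + X 2) ^ n) := by
      simp only [numerator, Polynomial.aeval_monomial, MvPolynomial.algebraMap_eq]; ring
    rw [h]
    exact Dvd.dvd.mul_left (dvd_pow_sum _ _ _ n) _

/-- `φ(x,y,z) = (f(x) + f(y) + f(z) + f(x+y+z)) / ((x+y)(x+z)(y+z))`, as a polynomial. -/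
def phi {F : Type*} [Field F] [CharP F 2] (f : Polynomial F) : MvPolynomial (Fin 3) F :=
  Classical.choose (denominator_dvd_numerator f)

/-- The equation that characterizes `phi f` (the ring of polynomials is a domain and the
denominator is not zero). -/
theorem denominator_mul_phi {F : Type*} [Field F] [CharP F 2] (f : Polynomial F) :
    denominator F * phi f = numerator f :=
  (Classical.choose_spec (denominator_dvd_numerator f)).symm

/-- The restriction `p(x,y,y)` of `p(x,y,z)` to the plane `y = z`, in the variables `x = X 0`,
`y = X 1`. -/
def restrictYZ {F : Type*} [Field F] (p : MvPolynomial (Fin 3) F) : MvPolynomial (Fin 2) F :=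
  aeval ![X 0, X 1, X 1] p

/-- A polynomial is absolutely irreducible if it is irreducible over the algebraic closure of its
field of coefficients. -/
def IsAbsolutelyIrreducible {F σ : Type*} [Field F] (p : MvPolynomial σ F) : Prop :=
  Irreducible (map (algebraMap F (AlgebraicClosure F)) p)

/-- The homogenization `t ^ deg p * p(x/t, y/t, z/t)` of `p(x,y,z)`, where `t = X 3`. -/
def homogenization {F : Type*} [Field F] (p : MvPolynomial (Fin 3) F) : MvPolynomial (Fin 4) F :=
  ∑ i ∈ Finset.range (p.totalDegree + 1),
    rename Fin.castSucc (homogeneousComponent i p) * X 3 ^ (p.totalDegree - i)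

/-- The Zariski topology on three dimensional projective space over `K`: the sets on which a
homogeneous polynomial does not vanish form a basis. -/
abbrev zariskiTopology (K : Type*) [Field K] :
    TopologicalSpace (Projectivization K (Fin 4 → K)) :=
  TopologicalSpace.generateFrom
    {U | ∃ (q : MvPolynomial (Fin 4) K) (n : ℕ), q.IsHomogeneous n ∧
      U = {P : Projectivization K (Fin 4 → K) | eval P.rep q ≠ 0}}

/-- The point `[x : y : z : 1]` of projective space. -/
def affinePoint {K : Type*} [Field K] (v : Fin 3 → K) : Projectivization K (Fin 4 → K) :=
  Projectivization.mk K ![v 0, v 1, v 2, 1] (fun h => one_ne_zero (congrFun h 3))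

/-- The geometric points of the projective closure of the affine surface `p(x,y,z) = 0`: the
Zariski closure, in projective space over the algebraic closure, of its zero set. -/
def projectiveClosure {F : Type*} [Field F] (p : MvPolynomial (Fin 3) F) :
    Set (Projectivization (AlgebraicClosure F) (Fin 4 → AlgebraicClosure F)) :=
  @closure _ (zariskiTopology (AlgebraicClosure F))
    (affinePoint '' {v : Fin 3 → AlgebraicClosure F | aeval v p = 0})

/-- The projective closure of the affine surface `p(x,y,z) = 0` is absolutely irreducible: its
equation, the homogenization of `p`, does not factor over the algebraic closure, and its set of
geometric points is irreducible in the Zariski topology. -/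
def ProjectiveSurfaceIsAbsolutelyIrreducible {F : Type*} [Field F]
    (p : MvPolynomial (Fin 3) F) : Prop :=
  IsAbsolutelyIrreducible (homogenization p) ∧
    @IsIrreducible _ (zariskiTopology (AlgebraicClosure F)) (projectiveClosure p)

end GoldAPN

end

/-!
Write `q = 2 ^ k = 2 m + 2` and let `K` be the algebraic closure. For `f = x ^ (q + 1) + g` the
polynomial `phi f` has degree `2 m`. If `phi f = A B` over `K` with both factors of positive
degree, then on the plane `y = z` the product of the restrictions is `P ^ 2`. Since `P` is
irreducible and no degree is lost in the restriction, `A` and `B` have the same degree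
`m = deg P`.

Consider the homogeneous components in the coordinates `x`, `a = x + y` and `b = x + z`. In
characteristic two the component of `phi f` of degree `e - 3` is, up to the coefficient of `x ^ e`
in `f`, equal to `(x ^ e + (x + a) ^ e + (x + b) ^ e + (x + a + b) ^ e) / (a b (a + b))`. It does
not involve `x` when `e` has at most two digits `1` in base two (`IsQuadraticExponent`). Otherwise
let `j` be the number formed by the two lowest digits `1` of `e`: by Lucas' theorem `x ^ (e - j)`
occurs, and `j` is small (`isQuadraticExponent_or_odd_choose`). The leading form of `phi f` is
`(a ^ q b + a b ^ q) / (a b (a + b))`. It does not involve `x`, and it is a product of distinct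
linear forms, so the leading forms of `A` and `B` are coprime polynomials in `a` and `b`.

Now compare components of `A B = phi f`, from the highest degree downwards
(`coeff_mem_range_C_of_mul`). If the higher components of `A` and `B` do not involve `x`, then
`A_m B_n + A_n B_m` agrees with a component of `phi f` up to terms without `x`. If the latter
involved `x`, then `x` would occur in it with an exponent larger than `n`, too large for `A_n` and
`B_n`; so it does not, and coprimality of `A_m` and `B_m` removes `x` from `A_n` and `B_n`. In the
end every exponent of `f` is quadratic. Then `phi f` is invariant under translation along the
diagonal, `P ^ 2` is a polynomial in `x + y`, and `P` is linear. Hence `m = 1`, that is `k = 2`,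
and in this case the same comparison shows that the coefficient of `x ^ 3` vanishes
(`coeff_three_eq_zero_of_phi_eq_mul`), contrary to the hypothesis.

Irreducibility of the homogenization follows by setting `t = 1` and counting degrees, and
irreducibility of the set of geometric points follows from the Nullstellensatz.
-/

namespace GoldAPN

/-! ### Binomial coefficients modulo two -/

theorem odd_choose_two_pow_mul (s x y : ℕ) :
    Odd ((2 ^ s * x).choose (2 ^ s * y)) ↔ Odd (x.choose y) := by
  induction s with
  | zero => simp
  | succ s ih =>
    have := Choose.choose_modEq_choose_mod_mul_choose_div_nat (p := 2)
      (n := 2 ^ (s + 1) * x) (k := 2 ^ (s + 1) * y)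
    rw [← ih, Nat.odd_iff, Nat.odd_iff, this]
    have h (u : ℕ) : 2 ^ (s + 1) * u % 2 = 0 ∧ 2 ^ (s + 1) * u / 2 = 2 ^ s * u := by
      rw [pow_succ, mul_right_comm, mul_comm _ 2]; omega
    simp [(h x).1, (h x).2, (h y).1, (h y).2]

theorem odd_choose_two_mul_add_one (x y : ℕ) :
    Odd ((2 * x + 1).choose (2 * y + 1)) ↔ Odd (x.choose y) := by
  have := Choose.choose_modEq_choose_mod_mul_choose_div_nat (p := 2)
    (n := 2 * x + 1) (k := 2 * y + 1)
  rw [Nat.odd_iff, Nat.odd_iff, this]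
  have h (u : ℕ) : (2 * u + 1) % 2 = 1 ∧ (2 * u + 1) / 2 = u := by omega
  simp [(h x).1, (h x).2, (h y).1, (h y).2]

/-- The exponents with at most two digits `1` in base two. -/
def IsQuadraticExponent (e : ℕ) : Prop :=
  e = 0 ∨ (∃ s, e = 2 ^ s) ∨ ∃ s r, e = 2 ^ s + 2 ^ r

/-- An exponent whose binary expansion has at least three digits `1` admits the number formed by
its two lowest digits `1` as an odd binomial coefficient; this number is small. -/
theorem isQuadraticExponent_or_odd_choose {k e : ℕ} (hk : 1 ≤ k) (he : e ≤ 2 ^ k) :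
    IsQuadraticExponent e ∨
      ∃ s r, 1 ≤ r ∧ 2 ^ s * (2 ^ r + 1) < e ∧ 2 ^ s * (2 ^ r + 1) < 2 ^ (k - 1) + 2 ∧
        Odd (e.choose (2 ^ s * (2 ^ r + 1))) := by
  rcases Nat.eq_zero_or_pos e with h0 | h0
  · exact .inl (.inl h0)
  obtain ⟨s, u, ⟨v, rfl⟩, rfl⟩ := Nat.exists_eq_two_pow_mul_odd h0.ne'
  rcases Nat.eq_zero_or_pos v with rfl | hv
  · exact .inl (.inr (.inl ⟨s, by simp⟩))
  obtain ⟨r, w, hw, rfl⟩ := Nat.exists_eq_two_pow_mul_odd hv.ne'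
  obtain ⟨c, rfl⟩ := hw
  -- Here `e = 2 ^ s * (2 ^ (r + 1) * (2 * c + 1) + 1)`: the two lowest digits `1` are those of
  -- `2 ^ s` and `2 ^ (s + r + 1)`.
  rcases Nat.eq_zero_or_pos c with rfl | hc
  · exact .inl (.inr (.inr ⟨s + (r + 1), s, by ring⟩))
  refine .inr ⟨s, r + 1, by omega, ?_, ?_, ?_⟩
  · apply Nat.mul_lt_mul_of_pos_left _ (by positivity)
    rw [pow_succ]
    have := Nat.two_pow_pos r
    nlinarith
  · have h1 : 2 ^ (s + r + 1) < 2 ^ k := by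
      refine lt_of_lt_of_le ?_ he
      have : 0 < 2 ^ s * 2 ^ r := by positivity
      have h2 : 0 < 2 ^ s * 2 ^ r * c := by positivity
      have h3 : 0 < 2 ^ s := by positivity
      rw [pow_succ, pow_add]
      nlinarith
    have h2 : s + r + 1 < k := (Nat.pow_lt_pow_iff_right (by norm_num)).1 h1
    have h3 : 2 ^ (s + r + 1) ≤ 2 ^ (k - 1) := Nat.pow_le_pow_right (by norm_num) (by omega)
    rcases Nat.lt_or_ge (s + r + 1) (k - 1) with h4 | h4
    · have h5 : 2 ^ (s + r + 1 + 1) ≤ 2 ^ (k - 1) := Nat.pow_le_pow_right (by norm_num) (by omega)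
      have h6 : 2 ^ s ≤ 2 ^ (s + r + 1) := Nat.pow_le_pow_right (by norm_num) (by omega)
      have h7 : 2 ^ s * (2 ^ (r + 1) + 1) = 2 ^ (s + r + 1) + 2 ^ s := by ring
      rw [pow_succ] at h5
      omega
    · exfalso
      have h8 : 2 ^ k = 2 * 2 ^ (s + r + 1) := by rw [← pow_succ']; congr 1; omega
      rw [h8] at he
      have h9 : 2 ^ s * (2 * (2 ^ r * (2 * c + 1)) + 1) =
          2 ^ (s + r + 1) * (2 * c + 1) + 2 ^ s := by
        ring
      rw [h9] at he
      have h10 : 2 ^ (s + r + 1) * (2 * c + 1) ≥ 2 ^ (s + r + 1) * 3 :=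
        Nat.mul_le_mul_left _ (by omega)
      have h11 : 0 < 2 ^ (s + r + 1) := by positivity
      have h12 : 0 < 2 ^ s := by positivity
      omega
  · have h1 : 2 ^ (r + 1) + 1 = 2 * (2 ^ r * 1) + 1 := by ring
    rw [odd_choose_two_pow_mul, h1, odd_choose_two_mul_add_one, odd_choose_two_pow_mul]
    simp

/-! ### Degrees under substitution -/

section degrees

open MvPolynomial

theorem totalDegree_aeval_le {K σ τ : Type*} [CommSemiring K] (v : σ → MvPolynomial τ K)
    (hv : ∀ i, (v i).totalDegree ≤ 1) (p : MvPolynomial σ K) :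
    (aeval v p).totalDegree ≤ p.totalDegree := by
  classical
  rw [aeval_def, eval₂_eq]
  refine totalDegree_finsetSum_le fun s hs => ?_
  rw [algebraMap_eq]
  refine (totalDegree_mul _ _).trans ?_
  rw [totalDegree_C, zero_add]
  refine (totalDegree_finsetProd _ _).trans ?_
  refine le_trans ?_ (le_totalDegree hs)
  refine Finset.sum_le_sum fun i _ => ?_
  refine (totalDegree_pow _ _).trans ?_
  simpa using Nat.mul_le_mul_left (s i) (hv i)

theorem natDegree_aeval_le {K T σ : Type*} [CommSemiring K] [CommSemiring T] [Algebra K T]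
    (v : σ → Polynomial T) (hv : ∀ i, (v i).natDegree ≤ 1) (p : MvPolynomial σ K) :
    (aeval v p).natDegree ≤ p.totalDegree := by
  classical
  rw [aeval_def, eval₂_eq]
  refine Polynomial.natDegree_sum_le_of_forall_le _ _ fun s hs => ?_
  rw [Polynomial.algebraMap_apply]
  refine (Polynomial.natDegree_C_mul_le _ _).trans ?_
  refine (Polynomial.natDegree_prod_le _ _).trans ?_
  refine le_trans ?_ (le_totalDegree hs)
  refine Finset.sum_le_sum fun i _ => ?_
  refine (Polynomial.natDegree_pow_le).trans ?_
  simpa using Nat.mul_le_mul_left (s i) (hv i)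

theorem isUnit_of_totalDegree_eq_zero {K σ : Type*} [Field K] {p : MvPolynomial σ K}
    (hp : p ≠ 0) (h : p.totalDegree = 0) : IsUnit p := by
  rw [totalDegree_eq_zero_iff_eq_C] at h
  rw [h] at hp ⊢
  exact (isUnit_iff_ne_zero.2 fun h0 => hp (by rw [h0, C_0])).map C

theorem totalDegree_eq_zero_of_isUnit {K σ : Type*} [Field K] {p : MvPolynomial σ K}
    (h : IsUnit p) : p.totalDegree = 0 := by
  obtain ⟨q, hq⟩ := h.exists_right_inv
  have h1 : p ≠ 0 := h.ne_zero
  have h2 : q ≠ 0 := fun h0 => by simp [h0] at hq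
  have := congrArg totalDegree hq
  rw [totalDegree_mul_of_isDomain h1 h2, totalDegree_one] at this
  omega

theorem totalDegree_pow_of_isDomain {K σ : Type*} [Field K] {p : MvPolynomial σ K}
    (hp : p ≠ 0) (n : ℕ) : (p ^ n).totalDegree = n * p.totalDegree := by
  induction n with
  | zero => simp
  | succ n ih => rw [pow_succ, totalDegree_mul_of_isDomain (pow_ne_zero n hp) hp, ih]; ring

end degrees

section components

open Polynomial

/-! ### Homogeneous components as polynomials in two variables -/

/-- The substitution `(x, y, z) ↦ (x s, (x + a) s, (x + 1) s)` into the ring `K[a][x][s]`. The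
coefficient of `s ^ n` in the image of `p` is the homogeneous component of degree `n` of `p`. In
characteristic two it is written in the coordinates `x`, `x + y` and `x + z` and dehomogenized by
`x + y = a` and `x + z = 1`. -/
noncomputable def spread (K : Type*) [Field K] : MvPolynomial (Fin 3) K →ₐ[K] K[X][X][X] :=
  MvPolynomial.aeval (![X * C X, X * C (X + C X), X * C (X + 1)] : Fin 3 → K[X][X][X])

theorem natDegree_spread_le {K : Type*} [Field K] (p : MvPolynomial (Fin 3) K) :
    (spread K p).natDegree ≤ p.totalDegree := by
  refine natDegree_aeval_le _ (fun i => ?_) p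
  have h (c : K[X][X]) : (X * C c).natDegree ≤ 1 :=
    (natDegree_mul_C_le _ _).trans natDegree_X_le
  fin_cases i <;> exact h _

/-- The polynomials in `K[a][x][s]` whose coefficient of `s ^ n` has total degree at most `n` in
`x` and `a`. -/
def gradedSubalgebra (K : Type*) [Field K] : Subalgebra K K[X][X][X] where
  carrier := {q | ∀ n i j, n < i + j → ((q.coeff n).coeff i).coeff j = 0}
  mul_mem' := by
    intro p q hp hq n i j h
    simp only [coeff_mul, finsetSum_coeff]
    refine Finset.sum_eq_zero fun u hu => Finset.sum_eq_zero fun v hv =>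
      Finset.sum_eq_zero fun w hw => ?_
    replace hu := Finset.HasAntidiagonal.mem_antidiagonal.1 hu
    replace hv := Finset.HasAntidiagonal.mem_antidiagonal.1 hv
    replace hw := Finset.HasAntidiagonal.mem_antidiagonal.1 hw
    by_cases h1 : u.1 < v.1 + w.1
    · rw [hp _ _ _ h1, zero_mul]
    · rw [hq _ _ _ (by omega), mul_zero]
  add_mem' := by
    intro p q hp hq n i j h
    simp [hp n i j h, hq n i j h]
  algebraMap_mem' := by
    intro r n i j h
    rw [Polynomial.algebraMap_apply, coeff_C]
    split_ifs with h1
    · rw [Polynomial.algebraMap_apply, coeff_C]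
      split_ifs with h2
      · rw [Polynomial.algebraMap_apply, coeff_C, if_neg (by omega)]
      · simp
    · simp

variable {K : Type*} [Field K]

theorem X_mul_C_mem_gradedSubalgebra {c : K[X][X]}
    (hc : ∀ i j, 1 < i + j → (c.coeff i).coeff j = 0) : X * C c ∈ gradedSubalgebra K := by
  intro n i j h
  rw [coeff_mul_C, coeff_X]
  split_ifs with h1
  · subst h1
    rw [one_mul]
    exact hc i j h
  · simp

theorem coeff_spread_eq_zero (p : MvPolynomial (Fin 3) K) {n i j : ℕ} (h : n < i + j) :
    (((spread K p).coeff n).coeff i).coeff j = 0 := by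
  have key : spread K p ∈ gradedSubalgebra K := by
    induction p using MvPolynomial.induction_on with
    | C a => rw [spread, MvPolynomial.aeval_C]; exact Subalgebra.algebraMap_mem _ _
    | add p q hp hq => rw [map_add]; exact add_mem hp hq
    | mul_X p i hp =>
      rw [map_mul]
      refine mul_mem hp ?_
      rw [spread, MvPolynomial.aeval_X]
      fin_cases i
      · exact X_mul_C_mem_gradedSubalgebra fun i j h => by
          rw [coeff_X]; split_ifs <;> simp [coeff_one]; omega
      · exact X_mul_C_mem_gradedSubalgebra fun i j h => by
          rw [coeff_add, coeff_add, coeff_X, coeff_C]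
          split_ifs <;> simp [coeff_one, coeff_X] <;> omega
      · exact X_mul_C_mem_gradedSubalgebra fun i j h => by
          rw [coeff_add, coeff_add, coeff_X, coeff_one]
          split_ifs <;> simp [coeff_one] <;> omega
  exact key n i j h

theorem natDegree_coeff_spread_le (p : MvPolynomial (Fin 3) K) (n i : ℕ) :
    (((spread K p).coeff n).coeff i).natDegree ≤ n - i := by
  rw [natDegree_le_iff_coeff_eq_zero]
  intro j hj
  exact coeff_spread_eq_zero p (by omega)

theorem coeff_aeval_X_mul_C {T : Type*} [CommRing T] [Algebra K T] (f : K[X]) (y : T) (n : ℕ) :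
    (aeval (X * C y) f).coeff n = algebraMap K T (f.coeff n) * y ^ n := by
  induction f using Polynomial.induction_on' with
  | add p q hp hq => rw [map_add, coeff_add, hp, hq, coeff_add, map_add, add_mul]
  | monomial e c =>
    rw [aeval_monomial, mul_pow, ← C_pow, Polynomial.algebraMap_apply, coeff_C_mul, coeff_mul_C,
      coeff_X_pow, coeff_monomial]
    by_cases h : n = e
    · subst h; simp
    · rw [if_neg h, if_neg (Ne.symm h)]; simp

theorem mul_differences {R : Type*} [CommRing R] [CharP R 2] (s x a : R) :
    (s * x + s * (x + a)) * (s * x + s * (x + 1)) * (s * (x + a) + s * (x + 1))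
      = a * (a + 1) * s ^ 3 := by
  have h2 : (2 : R) = 0 := CharTwo.two_eq_zero
  have h (u v : R) : u + (u + v) = v := by linear_combination u * h2
  have h3 : s * (x + a) + s * (x + 1) = s * (a + 1) := by linear_combination (s * x) * h2
  rw [h3, mul_add s x a, h, mul_add s x 1, h]
  ring

theorem sum_differences {R : Type*} [CommRing R] [CharP R 2] (s x a b : R) :
    s * x + s * (x + a) + s * (x + b) = s * (x + a + b) := by
  have h2 : (2 : R) = 0 := CharTwo.two_eq_zero
  linear_combination (s * x) * h2

theorem coeff_spread_phi [CharP K 2] (f : K[X]) (n : ℕ) :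
    C (X * (X + 1)) * (spread K (phi f)).coeff n = C (C (f.coeff (n + 3))) *
      (X ^ (n + 3) + (X + C X) ^ (n + 3) + (X + 1) ^ (n + 3) + (X + C X + 1) ^ (n + 3)) := by
  have h := congrArg (fun p => (spread K p).coeff (n + 3)) (denominator_mul_phi f)
  have hden : spread K (denominator K) = C (C (X * (X + 1))) * X ^ 3 := by
    simp only [spread, denominator, map_mul, map_add, MvPolynomial.aeval_X, Matrix.cons_val,
      map_one]
    exact mul_differences (R := K[X][X][X]) X (C X) (C (C X))
  have hnum : spread K (numerator f) = aeval (X * C X) f + aeval (X * C (X + C X)) f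
      + aeval (X * C (X + 1)) f + aeval (X * C (X + C X + 1)) f := by
    have h3 : (X * C X + X * C (X + C X) + X * C (X + 1) : K[X][X][X])
        = X * C (X + C X + 1) := by
      simp only [map_add]
      exact sum_differences (R := K[X][X][X]) X (C X) (C (C X)) (C 1)
    simp only [spread, numerator, map_add, ← Polynomial.aeval_algHom_apply, MvPolynomial.aeval_X,
      Matrix.cons_val] at h3 ⊢
    rw [h3]
  simp only [map_mul] at h
  rw [hden, hnum, mul_assoc, coeff_C_mul, coeff_X_pow_mul] at h
  rw [h]
  simp only [coeff_add, coeff_aeval_X_mul_C, Polynomial.algebraMap_apply, Algebra.algebraMap_self,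
    RingHom.id_apply]
  ring

/-! ### The leading form of the Gold polynomial -/

theorem mem_range_C_iff {R : Type*} [CommRing R] {p : R[X]} :
    p ∈ (C : R →+* R[X]).range ↔ ∀ l, l ≠ 0 → p.coeff l = 0 := by
  constructor
  · rintro ⟨c, rfl⟩ l hl
    rw [coeff_C, if_neg hl]
  · intro h
    refine ⟨p.coeff 0, ?_⟩
    ext l
    rw [coeff_C]
    split_ifs with hl
    · rw [hl]
    · rw [h l hl]

theorem exists_eq_C_of_C_mul_eq_C {R : Type*} [CommRing R] [IsDomain R] {h r : R} {p : R[X]}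
    (hh : h ≠ 0) (hp : C h * p = C r) : ∃ c, p = C c ∧ h * c = r := by
  refine ⟨p.coeff 0, ?_, ?_⟩
  · ext l
    have := congrArg (fun q => coeff q l) hp
    simp only [coeff_C_mul] at this
    rw [coeff_C] at this ⊢
    split_ifs at this ⊢ with hl
    · rw [hl]
    · exact (mul_eq_zero.1 this).resolve_left hh
  · simpa using congrArg (fun q => coeff q 0) hp

theorem gold_sum {R : Type*} [CommRing R] [CharP R 2] (k : ℕ) (x a : R) :
    x ^ (2 ^ k + 1) + (x + a) ^ (2 ^ k + 1) + (x + 1) ^ (2 ^ k + 1) + (x + a + 1) ^ (2 ^ k + 1)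
      = a ^ 2 ^ k + a := by
  have h2 : (2 : R) = 0 := CharTwo.two_eq_zero
  have : Fact (Nat.Prime 2) := ⟨Nat.prime_two⟩
  simp only [pow_succ _ (2 ^ k), add_pow_char_pow, one_pow]
  linear_combination (2 * x ^ 2 ^ k * x + x ^ 2 ^ k * a + a ^ 2 ^ k * x + x + x ^ 2 ^ k +
    a ^ 2 ^ k * a + 1) * h2

/-- The leading form of `phi f` for a Gold exponent is `(a ^ q + a) / (a (a + 1))` with `q = 2 ^ k`;
its roots are distinct, the elements of the field with `q` elements other than `0` and `1`. The
value at `a = 1` is the leading coefficient on the plane `y = z`. -/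
theorem leading_form [CharP K 2] {k m : ℕ} (hk : 1 ≤ k) (hm : 2 ^ k = 2 * m + 2) {f : K[X]}
    (hf : f.coeff (2 ^ k + 1) = 1) :
    ∃ c : K[X], (spread K (phi f)).coeff (m + m) = C c ∧ c.Separable ∧ c.natDegree = m + m ∧
      c.eval 1 = 1 := by
  have h2 : (2 : K) = 0 := CharTwo.two_eq_zero
  have hd : m + m + 3 = 2 ^ k + 1 := by omega
  have h := coeff_spread_phi f (m + m)
  rw [hd, hf, gold_sum, C_1, C_1, one_mul, ← C_pow, ← C_add] at h
  have hX : (X * (X + 1) : K[X]) ≠ 0 := mul_ne_zero X_ne_zero (X_add_C_ne_zero 1)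
  obtain ⟨c, hc, hc'⟩ := exists_eq_C_of_C_mul_eq_C hX h
  have hsub : (X ^ 2 ^ k + X : K[X]) = X ^ 2 ^ k - X := (CharTwo.sub_eq_add _ _).symm
  have hc0 : c ≠ 0 := by
    rintro rfl
    have : (X ^ 2 ^ k - X : K[X]).natDegree = 2 ^ k :=
      FiniteField.X_pow_card_sub_X_natDegree_eq K (Nat.one_lt_two_pow (by omega))
    rw [← hsub, ← hc', mul_zero, natDegree_zero] at this
    have := Nat.two_pow_pos k
    omega
  refine ⟨c, hc, ?_, ?_, ?_⟩
  · have hs : (X ^ 2 ^ k - X : K[X]).Separable :=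
      galois_poly_separable 2 _ (dvd_pow_self 2 (by omega))
    rw [← hsub, ← hc'] at hs
    exact hs.of_mul_right
  · have h1 : (X ^ 2 ^ k - X : K[X]).natDegree = 2 ^ k :=
      FiniteField.X_pow_card_sub_X_natDegree_eq K (Nat.one_lt_two_pow (by omega))
    have h3 : (X * (X + 1) : K[X]).natDegree = 2 := by
      rw [← C_1, natDegree_mul X_ne_zero (X_add_C_ne_zero 1), natDegree_X, natDegree_X_add_C]
    rw [← hsub, ← hc', natDegree_mul hX hc0, h3] at h1
    omega
  · have h1 := congrArg (fun p => (derivative p).eval 1) hc'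
    obtain ⟨j, rfl⟩ : ∃ j, k = j + 1 := ⟨k - 1, by omega⟩
    simp only [derivative_mul, derivative_add, derivative_X, derivative_one, derivative_X_pow,
      eval_add, eval_mul, eval_X, eval_one, eval_zero, eval_C, eval_pow, one_pow, pow_succ] at h1
    push_cast at h1
    linear_combination h1 + (2 ^ j - c.eval 1 - eval 1 (derivative c)) * h2

/-! ### Descent on the homogeneous components of a factorization -/

theorem eq_zero_of_mul_add_mul_eq_zero {a b α β : K[X]} (hab : IsCoprime a b)
    (h : a * β + α * b = 0) (hα : α.natDegree < a.natDegree) (hβ : β.natDegree < b.natDegree) :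
    α = 0 ∧ β = 0 := by
  constructor
  · refine eq_zero_of_dvd_of_natDegree_lt (hab.dvd_of_dvd_mul_right ⟨-β, ?_⟩) hα
    linear_combination h
  · refine eq_zero_of_dvd_of_natDegree_lt (hab.symm.dvd_of_dvd_mul_left ⟨-α, ?_⟩) hβ
    linear_combination h

/-- If the leading forms of two factors of the same degree do not involve `x` and are coprime, and
every component of the product that involves `x` does so with an exponent of `x` too large for the
components of the factors, then no component of the factors involves `x`. -/
theorem coeff_mem_range_C_of_mul {A B : K[X][X][X]} {m : ℕ} (hA : A.natDegree ≤ m)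
    (hB : B.natDegree ≤ m) (gA : A ∈ gradedSubalgebra K) (gB : B ∈ gradedSubalgebra K)
    {a b : K[X]} (hAm : A.coeff m = C a) (hBm : B.coeff m = C b) (hab : IsCoprime a b)
    (ha : a.natDegree = m) (hb : b.natDegree = m)
    (hc : ∀ n < 2 * m, (A * B).coeff n ∉ (C : K[X] →+* K[X][X]).range →
      ∃ l, n < m + l ∧ ((A * B).coeff n).coeff l ≠ 0) (n : ℕ) :
    A.coeff n ∈ (C : K[X] →+* K[X][X]).range ∧ B.coeff n ∈ (C : K[X] →+* K[X][X]).range := by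
  suffices H : ∀ t n, m ≤ n + t →
      A.coeff n ∈ (C : K[X] →+* K[X][X]).range ∧ B.coeff n ∈ (C : K[X] →+* K[X][X]).range from
    H m n (by omega)
  intro t
  induction t with
  | zero =>
    intro n hn
    rcases eq_or_lt_of_le hn with rfl | hn
    · exact ⟨⟨a, hAm.symm⟩, ⟨b, hBm.symm⟩⟩
    · rw [coeff_eq_zero_of_natDegree_lt (by omega), coeff_eq_zero_of_natDegree_lt (by omega)]
      exact ⟨zero_mem _, zero_mem _⟩
  | succ t ih =>
    intro n hn
    by_cases hn' : m ≤ n + t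
    · exact ih n hn'
    -- Products of components of degrees strictly between `n` and `m` do not involve `x`.
    have hprod (l : ℕ) (hl : l ≠ 0) : ((A * B).coeff (m + n)).coeff l
        = a * (B.coeff n).coeff l + (A.coeff n).coeff l * b := by
      rw [coeff_mul, finsetSum_coeff, Finset.sum_eq_add (m, n) (n, m), hAm, hBm, coeff_C_mul,
        coeff_mul_C]
      · intro h
        have := congrArg Prod.fst h
        simp only at this
        omega
      · rintro ⟨i, j⟩ hij ⟨h1, h2⟩
        replace hij := Finset.HasAntidiagonal.mem_antidiagonal.1 hij
        simp only [ne_eq, Prod.mk.injEq, not_and] at hij h1 h2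
        by_cases hi : m < i
        · rw [coeff_eq_zero_of_natDegree_lt (p := A) (by omega), zero_mul, coeff_zero]
        by_cases hj : m < j
        · rw [coeff_eq_zero_of_natDegree_lt (p := B) (by omega), mul_zero, coeff_zero]
        exact mem_range_C_iff.1
          (mul_mem (ih i (by omega)).1 (ih j (by omega)).2) l hl
      · exact fun h => (h (Finset.HasAntidiagonal.mem_antidiagonal.2 rfl)).elim
      · exact fun h => (h (Finset.HasAntidiagonal.mem_antidiagonal.2 (add_comm n m))).elim
    have hfree : (A * B).coeff (m + n) ∈ (C : K[X] →+* K[X][X]).range := by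
      by_contra hne
      obtain ⟨l, hl, hl'⟩ := hc (m + n) (by omega) hne
      apply hl'
      rw [hprod l (by omega)]
      have h1 : (A.coeff n).coeff l = 0 := by ext j; exact gA n l j (by omega)
      have h2 : (B.coeff n).coeff l = 0 := by ext j; exact gB n l j (by omega)
      rw [h1, h2, mul_zero, zero_mul, add_zero]
    -- The leading forms have degree `m > n`, so coprimality leaves no room for `x`.
    have hdeg {Q : K[X][X][X]} (gQ : Q ∈ gradedSubalgebra K) (l : ℕ) :
        ((Q.coeff n).coeff l).natDegree < m := by
      refine lt_of_le_of_lt ((natDegree_le_iff_coeff_eq_zero (n := n)).2 fun j hj => ?_)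
        (show n < m by omega)
      exact gQ n l j (by omega)
    have hzero (l : ℕ) (hl : l ≠ 0) : (A.coeff n).coeff l = 0 ∧ (B.coeff n).coeff l = 0 := by
      refine eq_zero_of_mul_add_mul_eq_zero hab ?_ (ha ▸ hdeg gA l) (hb ▸ hdeg gB l)
      rw [← hprod l hl, mem_range_C_iff.1 hfree l hl]
    exact ⟨mem_range_C_iff.2 fun l hl => (hzero l hl).1,
      mem_range_C_iff.2 fun l hl => (hzero l hl).2⟩

/-! ### The exponents that occur when the surface is reducible -/

theorem IsQuadraticExponent.sum_pow_add {e : ℕ} (he : IsQuadraticExponent e) {R : Type*}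
    [CommRing R] [CharP R 2] (x y z c : R) :
    (x + c) ^ e + (y + c) ^ e + (z + c) ^ e + (x + y + z + c) ^ e
      = x ^ e + y ^ e + z ^ e + (x + y + z) ^ e := by
  have h2 : (2 : R) = 0 := CharTwo.two_eq_zero
  have : Fact (Nat.Prime 2) := ⟨Nat.prime_two⟩
  rcases he with rfl | ⟨s, rfl⟩ | ⟨s, r, rfl⟩
  · simp
  · simp only [add_pow_char_pow]
    linear_combination (2 * c ^ 2 ^ s) * h2
  · simp only [pow_add _ (2 ^ s), add_pow_char_pow]
    linear_combination ((x ^ 2 ^ s + y ^ 2 ^ s + z ^ 2 ^ s) * c ^ 2 ^ r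
      + c ^ 2 ^ s * (x ^ 2 ^ r + y ^ 2 ^ r + z ^ 2 ^ r) + 2 * c ^ 2 ^ s * c ^ 2 ^ r) * h2

variable [CharP K 2]

/-- Translating by `x` removes `x` from the sum of powers that belongs to a quadratic exponent. -/
theorem IsQuadraticExponent.sum_pow_eq_C {e : ℕ} (he : IsQuadraticExponent e) :
    (X ^ e + (X + C X) ^ e + (X + 1) ^ e + (X + C X + 1) ^ e : K[X][X])
      = C (0 ^ e + X ^ e + 1 + (X + 1) ^ e) := by
  have h := he.sum_pow_add (R := K[X][X]) 0 (C X) 1 X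
  simp only [zero_add, one_pow] at h
  simp only [map_add, map_pow, map_zero, map_one]
  rw [← h, add_comm X (C X), add_comm X 1, add_right_comm (C X) X 1]

theorem coeff_spread_phi_mem_range {n : ℕ} (hn : IsQuadraticExponent (n + 3)) (f : K[X]) :
    (spread K (phi f)).coeff n ∈ (C : K[X] →+* K[X][X]).range := by
  have h := coeff_spread_phi f n
  rw [hn.sum_pow_eq_C, ← C_mul] at h
  obtain ⟨c, hc, -⟩ :=
    exists_eq_C_of_C_mul_eq_C (mul_ne_zero X_ne_zero (X_add_C_ne_zero (1 : K))) h
  exact ⟨c, hc.symm⟩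

/-- An exponent with at least three digits `1` in base two contributes to `phi f` a monomial in
which the exponent of `x` is large. -/
theorem exists_coeff_spread_phi_ne_zero {k n : ℕ} (hk : 1 ≤ k) (hn : n + 3 ≤ 2 ^ k)
    (hne : ¬ IsQuadraticExponent (n + 3)) {f : K[X]} (hf : f.coeff (n + 3) ≠ 0) :
    ∃ l, l ≠ 0 ∧ n + 1 < 2 ^ (k - 1) + l ∧ ((spread K (phi f)).coeff n).coeff l ≠ 0 := by
  have h2 : (2 : K[X]) = 0 := CharTwo.two_eq_zero
  have : Fact (Nat.Prime 2) := ⟨Nat.prime_two⟩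
  obtain ⟨s, r, hr, hj, hjk, hodd⟩ := (isQuadraticExponent_or_odd_choose hk hn).resolve_left hne
  set j := 2 ^ s * (2 ^ r + 1) with hjdef
  refine ⟨n + 3 - j, by omega, by omega, fun h0 => ?_⟩
  have h := congrArg (fun p => coeff p (n + 3 - j)) (coeff_spread_phi f n)
  simp only [coeff_C_mul, h0, mul_zero] at h
  have h3 := (mul_eq_zero.1 h.symm).resolve_left (C_ne_zero.2 hf)
  have hsub : n + 3 - (n + 3 - j) = j := by omega
  have hchoose : (((n + 3).choose (n + 3 - j) : ℕ) : K[X]) = 1 := by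
    rw [Nat.choose_symm hj.le]
    obtain ⟨u, hu⟩ := hodd
    rw [hu]
    push_cast
    rw [h2, zero_mul, zero_add]
  have hassoc : (X + C X + 1 : K[X][X]) = X + C (X + 1) := by rw [C_add, C_1, add_assoc]
  rw [hassoc, ← C_1] at h3
  simp only [coeff_add, coeff_X_add_C_pow, hsub, hchoose, coeff_X_pow, one_pow] at h3
  have hj0 : 0 < j := by positivity
  rw [if_neg (by omega)] at h3
  have hpow : (X + 1 : K[X]) ^ j = X ^ j + X ^ (2 ^ s * 2 ^ r) + X ^ 2 ^ s + 1 := by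
    rw [hjdef, mul_add, mul_one, pow_add, pow_add, ← pow_add 2 s r, add_pow_char_pow,
      add_pow_char_pow, one_pow, one_pow]
    ring
  have h4 : (X ^ (2 ^ s * 2 ^ r) : K[X]) = X ^ 2 ^ s := by
    rw [hpow] at h3
    linear_combination h3 - (X ^ j + 1 + X ^ 2 ^ s) * h2
  have h5 := congrArg natDegree h4
  rw [natDegree_X_pow, natDegree_X_pow] at h5
  have h6 : 1 < 2 ^ r := Nat.one_lt_two_pow (by omega)
  have h7 : 0 < 2 ^ s := Nat.two_pow_pos s
  nlinarith

/-- The leading forms of two factors of `phi f` of half its degree. -/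
theorem exists_coprime_leading_forms {k m : ℕ} (hk : 1 ≤ k) (hm : 2 ^ k = 2 * m + 2) {f : K[X]}
    (hf : f.coeff (2 ^ k + 1) = 1) {A B : MvPolynomial (Fin 3) K} (hAB : phi f = A * B)
    (hA : A.totalDegree ≤ m) (hB : B.totalDegree ≤ m) :
    ∃ a b : K[X], (spread K A).coeff m = C a ∧ (spread K B).coeff m = C b ∧ IsCoprime a b ∧
      a.natDegree = m ∧ b.natDegree = m := by
  obtain ⟨c, hc, hsep, hdeg, -⟩ := leading_form hk hm hf
  rw [hAB, map_mul, coeff_mul_add_eq_of_natDegree_le ((natDegree_spread_le A).trans hA)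
    ((natDegree_spread_le B).trans hB)] at hc
  have h0 : (spread K A).coeff m * (spread K B).coeff m ≠ 0 := by
    rw [hc, Ne, C_eq_zero]
    exact hsep.ne_zero
  have hA0 := left_ne_zero_of_mul h0
  have hB0 := right_ne_zero_of_mul h0
  have h1 := congrArg natDegree hc
  rw [natDegree_mul hA0 hB0, natDegree_C] at h1
  have hAC := eq_C_of_natDegree_eq_zero (p := (spread K A).coeff m) (by omega)
  have hBC := eq_C_of_natDegree_eq_zero (p := (spread K B).coeff m) (by omega)
  have hAd := natDegree_coeff_spread_le A m 0
  have hBd := natDegree_coeff_spread_le B m 0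
  rw [hAC, hBC] at hc
  rw [hAC] at hA0
  rw [hBC] at hB0
  rw [← C_mul, C_inj] at hc
  refine ⟨_, _, hAC, hBC, (hc ▸ hsep).isCoprime, ?_⟩
  rw [← hc, natDegree_mul (fun h => hA0 (by rw [h, C_0])) (fun h => hB0 (by rw [h, C_0]))] at hdeg
  omega

theorem isQuadraticExponent_of_phi_eq_mul {k m : ℕ} (hk : 1 ≤ k) (hm : 2 ^ k = 2 * m + 2)
    {f : K[X]} (hf : f.coeff (2 ^ k + 1) = 1) {A B : MvPolynomial (Fin 3) K} (hAB : phi f = A * B)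
    (hA : A.totalDegree ≤ m) (hB : B.totalDegree ≤ m) {e : ℕ} (he : e ≤ 2 ^ k)
    (hfe : f.coeff e ≠ 0) : IsQuadraticExponent e := by
  obtain ⟨a, b, ha, hb, hab, hda, hdb⟩ := exists_coprime_leading_forms hk hm hf hAB hA hB
  have hk2 : 2 ^ (k - 1) = m + 1 := by
    obtain ⟨i, rfl⟩ : ∃ i, k = i + 1 := ⟨k - 1, by omega⟩
    rw [pow_succ] at hm
    simp only [add_tsub_cancel_right]
    omega
  have key := coeff_mem_range_C_of_mul ((natDegree_spread_le A).trans hA)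
    ((natDegree_spread_le B).trans hB) (fun n i j h => coeff_spread_eq_zero A h)
    (fun n i j h => coeff_spread_eq_zero B h) ha hb hab hda hdb fun n hn hne => by
      rw [← map_mul, ← hAB] at hne ⊢
      have hq : ¬ IsQuadraticExponent (n + 3) := fun h => hne (coeff_spread_phi_mem_range h f)
      have hfn : f.coeff (n + 3) ≠ 0 := fun h => by
        have h1 := coeff_spread_phi f n
        rw [h, C_0, C_0, zero_mul, mul_eq_zero, C_eq_zero] at h1
        rw [h1.resolve_left (mul_ne_zero X_ne_zero (X_add_C_ne_zero (1 : K)))] at hne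
        exact hne (zero_mem _)
      obtain ⟨l, -, hl, hl'⟩ := exists_coeff_spread_phi_ne_zero hk (by omega) hq hfn
      exact ⟨l, by omega, hl'⟩
  by_contra hq
  have he3 : 3 ≤ e := by
    by_contra h
    have : e = 0 ∨ e = 2 ^ 0 ∨ e = 2 ^ 1 := by norm_num; omega
    rcases this with h | h | h
    · exact hq (.inl h)
    · exact hq (.inr (.inl ⟨_, h⟩))
    · exact hq (.inr (.inl ⟨_, h⟩))
  obtain ⟨n, rfl⟩ : ∃ n, e = n + 3 := ⟨e - 3, by omega⟩
  obtain ⟨l, hl0, -, hl⟩ := exists_coeff_spread_phi_ne_zero hk he hq hfe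
  refine hl (mem_range_C_iff.1 ?_ l hl0)
  rw [hAB, map_mul, coeff_mul]
  exact sum_mem fun i _ => mul_mem (key i.1).1 (key i.2).2

/-- For `f` of degree five, the linear component of `phi f` vanishes; as the leading forms are
coprime, factors of degree one have no constant terms, and then neither has `phi f`. -/
theorem coeff_three_eq_zero_of_phi_eq_mul {f : K[X]} (hf : f.coeff 5 = 1)
    {A B : MvPolynomial (Fin 3) K} (hAB : phi f = A * B)
    (hA : A.totalDegree ≤ 1) (hB : B.totalDegree ≤ 1) : f.coeff 3 = 0 := by
  have h2 : (2 : K[X]) = 0 := CharTwo.two_eq_zero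
  obtain ⟨a, b, ha, hb, hab, hda, hdb⟩ :=
    exists_coprime_leading_forms (k := 2) (by norm_num) (by norm_num) hf hAB hA hB
  have hX : (X * (X + 1) : K[X]) ≠ 0 := mul_ne_zero X_ne_zero (X_add_C_ne_zero 1)
  have h1 : (spread K (phi f)).coeff 1 = 0 := by
    have h := coeff_spread_phi f 1
    have h4 : IsQuadraticExponent 4 := .inr (.inl ⟨2, rfl⟩)
    have h5 : ((0 : K[X]) ^ 4 + X ^ 4 + 1 + (X + 1) ^ 4) = 0 := by
      linear_combination (X ^ 4 + 1 + 2 * X ^ 3 + 3 * X ^ 2 + 2 * X) * h2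
    rw [show 1 + 3 = 4 from rfl, h4.sum_pow_eq_C, h5, C_0, mul_zero, mul_eq_zero, C_eq_zero] at h
    exact h.resolve_left hX
  have h3 : (spread K A).coeff 0 = 0 ∧ (spread K B).coeff 0 = 0 := by
    have hC (Q : MvPolynomial (Fin 3) K) : (spread K Q).coeff 0 = C (((spread K Q).coeff 0).coeff 0)
        ∧ (((spread K Q).coeff 0).coeff 0).natDegree = 0 := by
      constructor
      · ext1 l
        rw [coeff_C]
        split_ifs with hl
        · rw [hl]
        · ext j
          exact coeff_spread_eq_zero Q (by omega)
      · simpa using natDegree_coeff_spread_le Q 0 0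
    rw [hAB, map_mul, mul_coeff_one] at h1
    rw [ha, hb, (hC A).1, (hC B).1, ← C_mul, ← C_mul, ← C_add, C_eq_zero, add_comm] at h1
    obtain ⟨hα, hβ⟩ := eq_zero_of_mul_add_mul_eq_zero hab h1 (by rw [(hC A).2]; omega)
      (by rw [(hC B).2]; omega)
    rw [(hC A).1, (hC B).1, hα, hβ, C_0]
    exact ⟨rfl, rfl⟩
  have h := coeff_spread_phi f 0
  have h4 : IsQuadraticExponent 3 := .inr (.inr ⟨0, 1, rfl⟩)
  have h5 : ((0 : K[X]) ^ 3 + X ^ 3 + 1 + (X + 1) ^ 3) = X * (X + 1) := by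
    linear_combination (X ^ 3 + 1 + X ^ 2 + X) * h2
  rw [zero_add, h4.sum_pow_eq_C, h5, hAB, map_mul (spread K), mul_coeff_zero, h3.1, zero_mul,
    mul_zero, ← C_mul, eq_comm, C_eq_zero, mul_eq_zero, C_eq_zero] at h
  exact h.resolve_right hX

end components

/-! ### Irreducibility of the affine equation -/

section affine

open MvPolynomial

variable {K : Type*} [Field K]

theorem X_add_X_ne_zero {i j : Fin 3} (h : i ≠ j) : (X i + X j : MvPolynomial (Fin 3) K) ≠ 0 := by
  intro h0
  have := congrArg (eval (Pi.single i (1 : K))) h0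
  simp [h.symm] at this

theorem denominator_ne_zero : denominator K ≠ 0 :=
  mul_ne_zero (mul_ne_zero (X_add_X_ne_zero (by decide)) (X_add_X_ne_zero (by decide)))
    (X_add_X_ne_zero (by decide))

theorem totalDegree_denominator : (denominator K).totalDegree = 3 :=
  IsHomogeneous.totalDegree
    ((((isHomogeneous_X K 0).add (isHomogeneous_X K 1)).mul
      ((isHomogeneous_X K 0).add (isHomogeneous_X K 2))).mul
      ((isHomogeneous_X K 1).add (isHomogeneous_X K 2))) denominator_ne_zero

variable [CharP K 2]

/-- If only exponents with at most two binary digits occur in `f`, then `phi f` is invariant under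
translation along the diagonal. -/
theorem aeval_phi_translate {f : Polynomial K} (hf : ∀ e, f.coeff e ≠ 0 → IsQuadraticExponent e) :
    aeval (![X 0 + X 1, 0, X 2 + X 1] : Fin 3 → MvPolynomial (Fin 3) K) (phi f) = phi f := by
  have h2 : (2 : MvPolynomial (Fin 3) K) = 0 := CharTwo.two_eq_zero
  set T := aeval (R := K) (![X 0 + X 1, 0, X 2 + X 1] : Fin 3 → MvPolynomial (Fin 3) K) with hT
  have hden : T (denominator K) = denominator K := by
    simp only [hT, denominator, map_mul, map_add, aeval_X, Matrix.cons_val]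
    linear_combination ((X 0 + X 1) * (X 2 + X 1) * X 1) * h2
  have hnum : T (numerator f) = numerator f := by
    have hX : T (X 0 + X 1 + X 2) = X 0 + X 1 + X 2 + X 1 := by
      simp only [hT, map_add, aeval_X, Matrix.cons_val]
      ring
    simp only [numerator, map_add, ← Polynomial.aeval_algHom_apply] at hX ⊢
    rw [hX]
    simp only [hT, aeval_X, Matrix.cons_val, Polynomial.aeval_eq_sum_range,
      ← Finset.sum_add_distrib, ← smul_add]
    refine Finset.sum_congr rfl fun e _ => ?_
    by_cases he : f.coeff e = 0
    · rw [he, zero_smul, zero_smul]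
    · rw [← (hf e he).sum_pow_add (X 0) (X 1) (X 2) (X 1), CharTwo.add_self_eq_zero (X 1)]
  apply mul_left_cancel₀ (denominator_ne_zero (K := K))
  rw [denominator_mul_phi, ← hnum, ← denominator_mul_phi, map_mul, hden]

/-- The translation that moves `y` to `0` turns `phi f` on the plane `y = z` into a polynomial in
`x + y`. -/
theorem restrictYZ_phi_eq_aeval {f : Polynomial K}
    (hf : ∀ e, f.coeff e ≠ 0 → IsQuadraticExponent e) :
    ∃ ψ : Polynomial K, restrictYZ (phi f) = Polynomial.aeval (X 0 + X 1) ψ := by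
  refine ⟨aeval ![Polynomial.X, 0, 0] (phi f), ?_⟩
  have key : (aeval (![X 0, X 1, X 1] : Fin 3 → MvPolynomial (Fin 2) K)).comp
      (aeval (![X 0 + X 1, 0, X 2 + X 1] : Fin 3 → MvPolynomial (Fin 3) K))
      = (Polynomial.aeval (X 0 + X 1 : MvPolynomial (Fin 2) K)).comp
        (aeval (![Polynomial.X, 0, 0] : Fin 3 → Polynomial K)) := by
    refine algHom_ext fun i => ?_
    fin_cases i <;> simp [CharTwo.add_self_eq_zero]
  have h := DFunLike.congr_fun key (phi f)
  rw [AlgHom.comp_apply, AlgHom.comp_apply, aeval_phi_translate hf] at h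
  exact h

theorem totalDegree_phi_le {f : Polynomial K} {n : ℕ} (hf : f.natDegree ≤ n + 3) :
    (phi f).totalDegree ≤ n := by
  by_cases h0 : phi f = 0
  · simp [h0]
  have h := congrArg totalDegree (denominator_mul_phi f)
  rw [totalDegree_mul_of_isDomain denominator_ne_zero h0] at h
  have hle (p : MvPolynomial (Fin 3) K) (hp : p.totalDegree ≤ 1) :
      (Polynomial.aeval p f).totalDegree ≤ n + 3 := by
    rw [Polynomial.aeval_eq_sum_range]
    refine totalDegree_finsetSum_le fun i hi => (totalDegree_smul_le _ _).trans ?_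
    refine (totalDegree_pow _ _).trans ?_
    rw [Finset.mem_range] at hi
    nlinarith
  have hX (i : Fin 3) : (X i : MvPolynomial (Fin 3) K).totalDegree ≤ 1 := (totalDegree_X i).le
  have hadd {p q : MvPolynomial (Fin 3) K} {j : ℕ} (hp : p.totalDegree ≤ j)
      (hq : q.totalDegree ≤ j) : (p + q).totalDegree ≤ j :=
    (totalDegree_add _ _).trans (max_le hp hq)
  have hnum : (numerator f).totalDegree ≤ n + 3 :=
    hadd (hadd (hadd (hle _ (hX 0)) (hle _ (hX 1))) (hle _ (hX 2)))
      (hle _ (hadd (hadd (hX 0) (hX 1)) (hX 2)))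
  have hden := totalDegree_denominator (K := K)
  omega

/-- The restriction to the plane `y = z` does not lower the degree of `phi f`: on the line
`(0, s, s)` in this plane, the coefficient of `s ^ (2 m)` is the value at `a = 1` of the leading
form. -/
theorem le_totalDegree_restrictYZ_phi {k m : ℕ} (hk : 1 ≤ k) (hm : 2 ^ k = 2 * m + 2)
    {f : Polynomial K} (hf : f.coeff (2 ^ k + 1) = 1) :
    m + m ≤ (restrictYZ (phi f)).totalDegree := by
  obtain ⟨c, hc, -, -, hc1⟩ := leading_form hk hm hf
  set ev : Polynomial (Polynomial K) →+* K := (Polynomial.evalRingHom 1).comp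
    (Polynomial.evalRingHom 0) with hev
  have key (p : MvPolynomial (Fin 3) K) : (spread K p).map ev
      = aeval (![0, Polynomial.X] : Fin 2 → Polynomial K) (restrictYZ p) := by
    rw [restrictYZ]
    induction p using MvPolynomial.induction_on with
    | C a =>
      rw [spread, aeval_C, aeval_C, algebraMap_eq, aeval_C, Polynomial.algebraMap_apply,
        Polynomial.algebraMap_apply, Polynomial.algebraMap_apply]
      simp [hev]
    | add p q hp hq => simp only [map_add, Polynomial.map_add, hp, hq]
    | mul_X p i hp =>
      have hX : (spread K (X i)).map ev = aeval (R := K) (![0, Polynomial.X] : Fin 2 → Polynomial K)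
          (aeval (R := K) (![X 0, X 1, X 1] : Fin 3 → MvPolynomial (Fin 2) K) (X i)) := by
        rw [spread, aeval_X, aeval_X]
        fin_cases i <;> simp [hev]
      rw [map_mul, Polynomial.map_mul, hp, hX, ← map_mul, ← map_mul]
  have h := natDegree_aeval_le (T := K) (![0, Polynomial.X] : Fin 2 → Polynomial K)
    (fun i => by fin_cases i <;> simp) (restrictYZ (phi f))
  rw [← key] at h
  refine le_trans (Polynomial.le_natDegree_of_ne_zero ?_) h
  rw [Polynomial.coeff_map, hc]
  simp [hev, hc1]

/-- The equation of the surface is irreducible. A factorization restricts on the plane `y = z` to a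
factorization of the square of `P`, so that both factors have degree `m = deg P`; the surface is
then a union of two surfaces of the same degree, which forces `f` to be quadratic, and the curve
`P = 0` to be a line. -/
theorem irreducible_phi [IsAlgClosed K] {k : ℕ} (hk : 1 ≤ k) {f : Polynomial K}
    (hfd : f.natDegree ≤ 2 ^ k + 1) (hf : f.coeff (2 ^ k + 1) = 1)
    (hexc : k = 2 → f.coeff 3 ≠ 0) {P : MvPolynomial (Fin 2) K} (hP : Irreducible P)
    (hsq : restrictYZ (phi f) = P ^ 2) : Irreducible (phi f) := by
  obtain ⟨m, hm⟩ : ∃ m, 2 ^ k = 2 * m + 2 := by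
    obtain ⟨i, rfl⟩ : ∃ i, k = i + 1 := ⟨k - 1, by omega⟩
    exact ⟨2 ^ i - 1, by have := Nat.two_pow_pos i; rw [pow_succ]; omega⟩
  have hP0 : P ≠ 0 := hP.ne_zero
  have hphi0 : phi f ≠ 0 := fun h => pow_ne_zero 2 hP0 (by rw [← hsq, h, restrictYZ, map_zero])
  have hrestr (p : MvPolynomial (Fin 3) K) : (restrictYZ p).totalDegree ≤ p.totalDegree :=
    totalDegree_aeval_le _ (fun i => by
      fin_cases i <;> exact (totalDegree_X (R := K) (σ := Fin 2) _).le) p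
  have hupper : (phi f).totalDegree ≤ m + m := totalDegree_phi_le (by omega)
  have hlower := le_totalDegree_restrictYZ_phi hk hm hf
  have hPdeg : P.totalDegree = m := by
    have := hrestr (phi f)
    rw [hsq, totalDegree_pow_of_isDomain hP0] at this hlower
    omega
  have hm0 : m ≠ 0 := fun h => hP.not_isUnit (isUnit_of_totalDegree_eq_zero hP0 (hPdeg.trans h))
  constructor
  · intro h
    have := totalDegree_eq_zero_of_isUnit h
    have := hrestr (phi f)
    omega
  intro A B hAB
  by_contra! hnu
  have hA0 : A ≠ 0 := fun h => hphi0 (by rw [hAB, h, zero_mul])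
  have hB0 : B ≠ 0 := fun h => hphi0 (by rw [hAB, h, mul_zero])
  have hmul : restrictYZ A * restrictYZ B = P ^ 2 := by
    rw [← hsq, hAB, restrictYZ, restrictYZ, restrictYZ, map_mul]
  have hrA0 : restrictYZ A ≠ 0 := fun h => pow_ne_zero 2 hP0 (by rw [← hmul, h, zero_mul])
  have hrB0 : restrictYZ B ≠ 0 := fun h => pow_ne_zero 2 hP0 (by rw [← hmul, h, mul_zero])
  have hdeg := hupper
  rw [hAB, totalDegree_mul_of_isDomain hA0 hB0] at hdeg
  have hdeg' := congrArg totalDegree hmul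
  rw [totalDegree_mul_of_isDomain hrA0 hrB0, totalDegree_pow_of_isDomain hP0, hPdeg] at hdeg'
  have hAr := hrestr A
  have hBr := hrestr B
  -- A divisor of a power of `P` has a degree divisible by `m`; here it is neither `0` nor `2 m`.
  have hdvd {Q : MvPolynomial (Fin 2) K} (h : Q ∣ P ^ 2) : ∃ i, Q.totalDegree = i * m := by
    obtain ⟨i, -, hi⟩ := (dvd_prime_pow hP.prime 2).1 h
    refine ⟨i, ?_⟩
    obtain ⟨u, hu⟩ := hi
    have hQ0 : Q ≠ 0 := fun h0 => pow_ne_zero i hP0 (by rw [← hu, h0, zero_mul])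
    rw [← hPdeg, ← totalDegree_pow_of_isDomain hP0, ← hu, totalDegree_mul_of_isDomain hQ0 u.ne_zero,
      totalDegree_eq_zero_of_isUnit u.isUnit, add_zero]
  have hApos : A.totalDegree ≠ 0 := fun h => hnu.1 (isUnit_of_totalDegree_eq_zero hA0 h)
  have hBpos : B.totalDegree ≠ 0 := fun h => hnu.2 (isUnit_of_totalDegree_eq_zero hB0 h)
  have hAm : A.totalDegree = m := by
    obtain ⟨i, hi⟩ := hdvd (Dvd.intro _ hmul)
    have hieq : A.totalDegree = i * m := by omega
    have h0 : i ≠ 0 := by rintro rfl; simp at hieq; exact hApos (by simp [hieq])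
    have h2 : i < 2 := by
      by_contra h2
      have : 2 * m ≤ i * m := Nat.mul_le_mul_right m (by omega)
      omega
    obtain rfl : i = 1 := by omega
    omega
  have hBm : B.totalDegree = m := by omega
  have hquad (e : ℕ) (he : f.coeff e ≠ 0) : IsQuadraticExponent e := by
    have hle := (Polynomial.le_natDegree_of_ne_zero he).trans hfd
    rcases hle.eq_or_lt with rfl | hlt
    · exact .inr (.inr ⟨k, 0, by simp⟩)
    · exact isQuadraticExponent_of_phi_eq_mul hk hm hf hAB hAm.le hBm.le (by omega) he
  obtain ⟨ψ, hψ⟩ := restrictYZ_phi_eq_aeval hquad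
  -- A root of `ψ` gives a divisor of `P ^ 2` of degree one.
  have hm1 : m = 1 := by
    have hψdeg : ψ.degree ≠ 0 := by
      intro h0
      rw [Polynomial.eq_C_of_degree_eq_zero h0, Polynomial.aeval_C, hsq] at hψ
      have := congrArg totalDegree hψ
      rw [totalDegree_pow_of_isDomain hP0, hPdeg, algebraMap_eq, totalDegree_C] at this
      omega
    obtain ⟨θ, hθ⟩ := IsAlgClosed.exists_root ψ hψdeg
    obtain ⟨χ, rfl⟩ := Polynomial.dvd_iff_isRoot.2 hθ
    rw [map_mul, map_sub, Polynomial.aeval_X, Polynomial.aeval_C, algebraMap_eq, hsq] at hψ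
    obtain ⟨i, hi⟩ := hdvd (Dvd.intro _ hψ.symm)
    have h1 : (X 0 + X 1 - C θ : MvPolynomial (Fin 2) K).totalDegree = 1 := by
      have hne : (X 0 + X 1 : MvPolynomial (Fin 2) K) ≠ 0 := fun h0 => by
        simpa using congrArg (eval (Pi.single 0 (1 : K))) h0
      have hone := ((isHomogeneous_X K (0 : Fin 2)).add (isHomogeneous_X K 1)).totalDegree hne
      rw [sub_eq_add_neg, ← C_neg, totalDegree_add_eq_left_of_totalDegree_lt, hone]
      rw [totalDegree_C, hone]
      exact one_pos
    rw [h1] at hi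
    exact Nat.eq_one_of_mul_eq_one_left hi.symm
  subst hm1
  have hk2 : k = 2 := Nat.pow_right_injective le_rfl (by simpa using hm)
  subst hk2
  exact hexc rfl (coeff_three_eq_zero_of_phi_eq_mul (by simpa using hf) hAB hAm.le hBm.le)

end affine

/-! ### Projective closure -/

section projective

open MvPolynomial

variable {K : Type*} [Field K]

/-- Setting `t = 1` undoes the homogenization. -/
theorem aeval_homogenization (p : MvPolynomial (Fin 3) K) :
    aeval (![X 0, X 1, X 2, 1] : Fin 4 → MvPolynomial (Fin 3) K) (homogenization p) = p := by
  have hcomp : (![X 0, X 1, X 2, 1] : Fin 4 → MvPolynomial (Fin 3) K) ∘ Fin.castSucc = X := by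
    funext i
    fin_cases i <;> rfl
  rw [homogenization, map_sum]
  conv_rhs => rw [← sum_homogeneousComponent p]
  refine Finset.sum_congr rfl fun i _ => ?_
  rw [map_mul, map_pow, aeval_X, aeval_rename, hcomp, aeval_X_left_apply]
  simp

theorem totalDegree_homogenization_le (p : MvPolynomial (Fin 3) K) :
    (homogenization p).totalDegree ≤ p.totalDegree := by
  refine totalDegree_finsetSum_le fun i hi => ?_
  have h1 : (rename Fin.castSucc (homogeneousComponent i p)).totalDegree ≤ i :=
    (totalDegree_rename_le _ _).trans (homogeneousComponent_isHomogeneous i p).totalDegree_le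
  have h2 := totalDegree_X_pow (R := K) (3 : Fin 4) (p.totalDegree - i)
  have := totalDegree_mul (rename Fin.castSucc (homogeneousComponent i p))
    ((X 3 : MvPolynomial (Fin 4) K) ^ (p.totalDegree - i))
  rw [Finset.mem_range] at hi
  omega

/-- A factor of the homogenization that becomes constant for `t = 1` leaves no room for its own
degree, because the other factor has at least the degree of `p`. -/
theorem irreducible_homogenization {p : MvPolynomial (Fin 3) K} (hp : Irreducible p) :
    Irreducible (homogenization p) := by
  set T := aeval (R := K) (![X 0, X 1, X 2, 1] : Fin 4 → MvPolynomial (Fin 3) K) with hT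
  have hTp : T (homogenization p) = p := aeval_homogenization p
  have hdeg (q : MvPolynomial (Fin 4) K) : (T q).totalDegree ≤ q.totalDegree :=
    totalDegree_aeval_le _ (fun i => by
      fin_cases i
      · exact (totalDegree_X (R := K) (0 : Fin 3)).le
      · exact (totalDegree_X (R := K) (1 : Fin 3)).le
      · exact (totalDegree_X (R := K) (2 : Fin 3)).le
      · exact totalDegree_one.le.trans zero_le_one) q
  have h0 : homogenization p ≠ 0 := fun h => hp.ne_zero (by rw [← hTp, h, map_zero])
  have key {G H : MvPolynomial (Fin 4) K} (hGH : homogenization p = G * H) (hG : IsUnit (T G)) :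
      IsUnit G := by
    have hG0 : G ≠ 0 := fun h => h0 (by rw [hGH, h, zero_mul])
    have hH0 : H ≠ 0 := fun h => h0 (by rw [hGH, h, mul_zero])
    refine isUnit_of_totalDegree_eq_zero hG0 ?_
    have h1 := totalDegree_homogenization_le p
    rw [hGH, totalDegree_mul_of_isDomain hG0 hH0] at h1
    have h2 : p = T G * T H := by rw [← map_mul, ← hGH, hTp]
    have h3 : T H ≠ 0 := fun h => hp.ne_zero (by rw [h2, h, mul_zero])
    have h4 := congrArg totalDegree h2
    rw [totalDegree_mul_of_isDomain hG.ne_zero h3, totalDegree_eq_zero_of_isUnit hG] at h4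
    have := hdeg H
    omega
  constructor
  · intro h
    exact hp.not_isUnit (hTp ▸ h.map T)
  · intro G H hGH
    have h2 : p = T G * T H := by rw [← map_mul, ← hGH, hTp]
    rcases hp.isUnit_or_isUnit h2 with h | h
    · exact .inl (key hGH h)
    · exact .inr (key (hGH.trans (mul_comm _ _)) h)

theorem eval_smul_of_isHomogeneous {σ : Type*} {q : MvPolynomial σ K} {n : ℕ}
    (hq : q.IsHomogeneous n) (a : K) (v : σ → K) : eval (a • v) q = a ^ n * eval v q := by
  rw [eval_eq, eval_eq, Finset.mul_sum]
  refine Finset.sum_congr rfl fun d hd => ?_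
  have hdeg := hq.degree_eq_sum_deg_support hd
  simp only [Pi.smul_apply, smul_eq_mul, mul_pow, Finset.prod_mul_distrib,
    Finset.prod_pow_eq_pow_sum, ← hdeg]
  ring

theorem eval_rep_affinePoint_ne_zero_iff {q : MvPolynomial (Fin 4) K} {n : ℕ}
    (hq : q.IsHomogeneous n) (v : Fin 3 → K) :
    eval (affinePoint v).rep q ≠ 0 ↔
      eval v (aeval (![X 0, X 1, X 2, 1] : Fin 4 → MvPolynomial (Fin 3) K) q) ≠ 0 := by
  have hv : eval v (aeval (![X 0, X 1, X 2, 1] : Fin 4 → MvPolynomial (Fin 3) K) q)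
      = eval ![v 0, v 1, v 2, 1] q := by
    rw [← coe_aeval_eq_eval, ← coe_aeval_eq_eval]
    change ((aeval v).comp (aeval _)) q = aeval _ q
    congr 1
    refine algHom_ext fun i => ?_
    fin_cases i <;> simp
  obtain ⟨a, ha⟩ := Projectivization.exists_smul_eq_mk_rep K ![v 0, v 1, v 2, 1]
    (fun h => one_ne_zero (congrFun h 3))
  rw [hv, affinePoint, ← ha, Units.smul_def, eval_smul_of_isHomogeneous hq]
  simp

/-- The basic sets of the Zariski topology form a basis: every neighbourhood contains one. -/
theorem exists_basic_subset_of_isOpen {U : Set (Projectivization K (Fin 4 → K))}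
    (hU : @IsOpen _ (zariskiTopology K) U) {P : Projectivization K (Fin 4 → K)} (hP : P ∈ U) :
    ∃ (q : MvPolynomial (Fin 4) K) (n : ℕ), q.IsHomogeneous n ∧ eval P.rep q ≠ 0 ∧
      ∀ Q : Projectivization K (Fin 4 → K), eval Q.rep q ≠ 0 → Q ∈ U := by
  induction hU with
  | basic V hV =>
    obtain ⟨q, n, hq, rfl⟩ := hV
    exact ⟨q, n, hq, hP, fun Q hQ => hQ⟩
  | univ => exact ⟨1, 0, isHomogeneous_one _ _, by simp, fun Q _ => trivial⟩
  | inter V W _ _ ihV ihW =>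
    obtain ⟨q, n, hq, hqP, hqV⟩ := ihV hP.1
    obtain ⟨r, l, hr, hrP, hrW⟩ := ihW hP.2
    refine ⟨q * r, n + l, hq.mul hr, by rw [map_mul]; exact mul_ne_zero hqP hrP, fun Q hQ => ?_⟩
    rw [map_mul] at hQ
    exact ⟨hqV Q (left_ne_zero_of_mul hQ), hrW Q (right_ne_zero_of_mul hQ)⟩
  | sUnion S _ ih =>
    obtain ⟨V, hV, hPV⟩ := hP
    obtain ⟨q, n, hq, hqP, hqV⟩ := ih V hV hPV
    exact ⟨q, n, hq, hqP, fun Q hQ => ⟨V, hV, hqV Q hQ⟩⟩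

/-- By the Nullstellensatz, the polynomials that vanish on the surface form the prime ideal
generated by its equation. -/
theorem isIrreducible_affinePoint_image [IsAlgClosed K] {p : MvPolynomial (Fin 3) K}
    (hp : Irreducible p) :
    @IsIrreducible _ (zariskiTopology K) (affinePoint '' {v : Fin 3 → K | eval v p = 0}) := by
  let := zariskiTopology K
  have hprime : (Ideal.span {p}).IsPrime := (Ideal.span_singleton_prime hp.ne_zero).2 hp.prime
  have hnull := IsPrime.vanishingIdeal_zeroLocus (K := K) (Ideal.span {p})
  have hlocus : zeroLocus K (Ideal.span {p}) = {v : Fin 3 → K | eval v p = 0} := by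
    rw [zeroLocus_span]
    ext v
    simp [aeval_eq_eval]
  rw [hlocus] at hnull
  have hex {q : MvPolynomial (Fin 3) K} (hq : q ∉ Ideal.span {p}) :
      ∃ v : Fin 3 → K, eval v p = 0 ∧ eval v q ≠ 0 := by
    rw [← hnull, mem_vanishingIdeal_iff] at hq
    push Not at hq
    obtain ⟨v, hv, hqv⟩ := hq
    exact ⟨v, hv, by rwa [aeval_eq_eval] at hqv⟩
  have hnot {q : MvPolynomial (Fin 3) K} {v : Fin 3 → K} (hv : eval v p = 0)
      (hq : eval v q ≠ 0) : q ∉ Ideal.span {p} := by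
    intro h
    obtain ⟨r, rfl⟩ := Ideal.mem_span_singleton'.1 h
    exact hq (by rw [map_mul, hv, mul_zero])
  constructor
  · obtain ⟨v, hv, -⟩ := hex (q := 1) ((Ideal.ne_top_iff_one _).1 hprime.ne_top)
    exact ⟨_, v, hv, rfl⟩
  · rintro U V hU hV ⟨_, ⟨v, hv, rfl⟩, hvU⟩ ⟨_, ⟨w, hw, rfl⟩, hwV⟩
    obtain ⟨q, n, hq, hqv, hqU⟩ := exists_basic_subset_of_isOpen hU hvU
    obtain ⟨r, l, hr, hrw, hrV⟩ := exists_basic_subset_of_isOpen hV hwV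
    rw [eval_rep_affinePoint_ne_zero_iff hq] at hqv
    rw [eval_rep_affinePoint_ne_zero_iff hr] at hrw
    have hmul := fun h => (hprime.mem_or_mem h).elim (hnot hv hqv) (hnot hw hrw)
    obtain ⟨u, hu, hu'⟩ := hex hmul
    rw [map_mul] at hu'
    exact ⟨_, ⟨u, hu, rfl⟩,
      hqU _ ((eval_rep_affinePoint_ne_zero_iff hq u).2 (left_ne_zero_of_mul hu')),
      hrV _ ((eval_rep_affinePoint_ne_zero_iff hr u).2 (right_ne_zero_of_mul hu'))⟩

end projective

/-! ### Extension of the base field -/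

section baseChange

open MvPolynomial

variable {F K : Type*} [Field F] [Field K] (i : F →+* K)

theorem map_aeval_polynomial {σ : Type*} (f : Polynomial F) (p : MvPolynomial σ F) :
    map i (Polynomial.aeval p f) = Polynomial.aeval (map i p) (f.map i) := by
  rw [Polynomial.aeval_def, Polynomial.aeval_def, Polynomial.eval₂_map, Polynomial.hom_eval₂]
  congr 1
  ext
  simp [algebraMap_eq]

theorem map_phi [CharP F 2] [CharP K 2] (f : Polynomial F) :
    map i (phi f) = phi (f.map i) := by
  apply mul_left_cancel₀ (denominator_ne_zero (K := K))
  have hden : denominator K = map i (denominator F) := by simp [denominator]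
  rw [denominator_mul_phi, hden, ← map_mul, denominator_mul_phi]
  simp [numerator, map_aeval_polynomial]

theorem map_restrictYZ (p : MvPolynomial (Fin 3) F) :
    map i (restrictYZ p) = restrictYZ (map i p) := by
  have hC : (map i).comp (C : F →+* MvPolynomial (Fin 2) F) = C.comp i :=
    RingHom.ext fun a => by simp
  rw [restrictYZ, restrictYZ, map_aeval, aeval_def, eval₂_map, coe_eval₂Hom, algebraMap_eq,
    algebraMap_eq, hC]
  congr 1
  funext j
  fin_cases j <;> simp

theorem map_homogenization (p : MvPolynomial (Fin 3) F) :
    map i (homogenization p) = homogenization (map i p) := by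
  have hdeg : (map i p).totalDegree = p.totalDegree := by
    rw [totalDegree, totalDegree, support_map_of_injective _ i.injective]
  have hcomp (n : ℕ) : map i (homogeneousComponent n p) = homogeneousComponent n (map i p) := by
    classical
    ext d
    rw [coeff_map, coeff_homogeneousComponent, coeff_homogeneousComponent, coeff_map]
    split_ifs <;> simp
  simp only [homogenization, map_sum, map_mul, map_pow, map_X, map_rename, hcomp, hdeg]

end baseChange

end GoldAPN

theorem mainTheorem5 {F : Type*} [Field F] [Finite F] [CharP F 2]
    (k : ℕ) (hk : 1 ≤ k)
    (g : Polynomial F) (hg : g.degree < ((2 ^ k + 1 : ℕ) : WithBot ℕ))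
    (hexc : k = 2 → g.coeff 3 ≠ 0)
    (hsq : ∃ P : MvPolynomial (Fin 2) F, GoldAPN.IsAbsolutelyIrreducible P ∧
      GoldAPN.restrictYZ (GoldAPN.phi (Polynomial.X ^ (2 ^ k + 1) + g)) = P ^ 2) :
    GoldAPN.ProjectiveSurfaceIsAbsolutelyIrreducible
      (GoldAPN.phi (Polynomial.X ^ (2 ^ k + 1) + g)) := by
  obtain ⟨P, hP, hPsq⟩ := hsq
  set f : Polynomial F := Polynomial.X ^ (2 ^ k + 1) + g with hf
  set i := algebraMap F (AlgebraicClosure F) with hi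
  have : CharP (AlgebraicClosure F) 2 := charP_of_injective_algebraMap i.injective 2
  have hfd : f.natDegree ≤ 2 ^ k + 1 := by
    rw [Polynomial.natDegree_le_iff_degree_le]
    refine (Polynomial.degree_add_le _ _).trans (max_le (Polynomial.degree_X_pow_le _) hg.le)
  have hfc : f.coeff (2 ^ k + 1) = 1 := by
    rw [hf, Polynomial.coeff_add, Polynomial.coeff_X_pow_self,
      Polynomial.coeff_eq_zero_of_degree_lt hg, add_zero]
  have hf3 : k = 2 → f.coeff 3 ≠ 0 := by
    rintro rfl
    rw [hf, Polynomial.coeff_add, Polynomial.coeff_X_pow, if_neg (by norm_num), zero_add]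
    exact hexc rfl
  have hirr : Irreducible (MvPolynomial.map i (GoldAPN.phi f)) := by
    rw [GoldAPN.map_phi]
    refine GoldAPN.irreducible_phi hk (Polynomial.natDegree_map_le.trans hfd) ?_ ?_ hP ?_
    · rw [Polynomial.coeff_map, hfc, map_one]
    · intro h
      rw [Polynomial.coeff_map]
      exact (map_ne_zero i).2 (hf3 h)
    · rw [← GoldAPN.map_phi, ← GoldAPN.map_restrictYZ, hPsq, map_pow]
  constructor
  · rw [GoldAPN.IsAbsolutelyIrreducible, GoldAPN.map_homogenization]
    exact GoldAPN.irreducible_homogenization hirr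
  · let := GoldAPN.zariskiTopology (AlgebraicClosure F)
    have h := (GoldAPN.isIrreducible_affinePoint_image hirr).closure
    simp only [MvPolynomial.eval_map, ← MvPolynomial.aeval_def, hi] at h
    exact h
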